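/- Let $N\ge 1$ assets and $N$ futures contracts be given, with interest rate $r\ge 0$, trading horizon $T>0$, expiry dates $T_i>T$, constants $\mu_{i,F},\mu_{i,S}$ and $\eta_{i,F}<\eta_{i,S}$ ($i=1,\dots,N$), and a $2N\times 2N$ lower triangular matrix $\tilde\Sigma$ such that $\Sigma:=\tilde\Sigma\tilde\Sigma^\top=\begin{pmatrix}\Sigma_F&\Sigma_{FS}\\ \Sigma_{FS}^\top&\Sigma_S\end{pmatrix}$ (with $N\times N$ blocks) is positive definite. Put $$\kappa_i:=\eta_{i,S}-\eta_{i,F}>0,\qquad m_i:=r+\mu_{i,F}-\mu_{i,S}-\tfrac12\big(\Sigma_{i,i}-\Sigma_{N+i,N+i}\big),$$ $$\tilde\Sigma_Z:=[I_N,-I_N]\,\tilde\Sigma,\qquad m:=(m_1,\dots,m_N)^\top .$$ Let $W$ be a standard $2N$-dimensional Brownian motion on $[0,T]$, and let the log-basis process $(Z_t)_{0\le t\le T}$, with values in $\mathbb R^N$, be given by $$\operatorname{diag}\Big(\big(\tfrac{T_i}{T_i-t}\big)^{\kappa_i}\Big)Z_t=Z_0+\int_0^t\operatorname{diag}\Big(\big(\tfrac{T_i}{T_i-s}\big)^{\kappa_i}\Big)m\,ds+\int_0^t\operatorname{diag}\Big(\big(\tfrac{T_i}{T_i-s}\big)^{\kappa_i}\Big)\tilde\Sigma_Z\,dW_s,\qquad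 0\le t\le T,$$ almost surely. Let $M$ be a positive integer. Then, almost surely, for $n\in\{1,\dots,M\}$, $$\operatorname{diag}\Big(\big(\tfrac{T_i}{T_i-nT/M}\big)^{\kappa_i}\Big)Z_{nT/M}=\operatorname{diag}\Big(\big(\tfrac{T_i}{T_i-(n-1)T/M}\big)^{\kappa_i}\Big)Z_{(n-1)T/M}+\operatorname{diag}(\phi_{n,i})\,m+e_n,$$ where $$\phi_{n,i}:=\begin{cases}\dfrac{T_i^{\kappa_i}}{\kappa_i-1}\Big(\big(T_i-\tfrac{nT}{M}\big)^{1-\kappa_i}-\big(T_i-\tfrac{(n-1)T}{M}\big)^{1-\kappa_i}\Big),&\kappa_i\ne 1,\\[2ex] T_i\ln\left(\dfrac{T_i-\frac{(n-1)T}{M}}{T_i-\frac{nT}{M}}\right),&\kappa_i=1,\end{cases}$$ and $e_1,\dots,e_M$ are independent Gaussian random vectors in $\mathbb R^N$ with mean zero and covariance matrices $\mathbb E(e_ne_n^\top)=[\eta_{ij;n}]_{N\times N}$, $$\eta_{ij;n}:=\beta_{ij}\int_{(n-1)T/M}^{nT/M}\Big(\frac{T_i}{T_i-s}\Big)^{\kappa_i}\Big(\frac{T_j}{T_j-s}\Big)^{\kappa_j}ds,$$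 with $\beta_{ij}$ the entries of $\Sigma_Z:=\tilde\Sigma_Z\tilde\Sigma_Z^\top=\Sigma_F+\Sigma_S-\Sigma_{FS}-\Sigma_{FS}^\top$. -/

import Mathlib

open MeasureTheory ProbabilityTheory Filter Topology Matrix

noncomputable section

namespace FuturesBasis

/-! ### Brownian motion and integrals of deterministic functions against it -/

/-- `W` is a standard Brownian motion on `[0, T]` with values in `ℝ^ι` (the values of `W` at times
outside `[0, T]` play no role). -/
structure IsStdBrownian {Ω ι : Type*} [MeasurableSpace Ω] [Fintype ι]
    (T : ℝ) (W : ℝ → Ω → ι → ℝ) (P : Measure Ω) : Prop where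
  start_zero : ∀ᵐ ω ∂P, W 0 ω = 0
  indep_increments : HasIndepIncrements (fun (t : Set.Icc (0 : ℝ) T) => W t) P
  law_increments : ∀ s t : ℝ, 0 ≤ s → s ≤ t → t ≤ T →
    HasLaw (fun ω => W t ω - W s ω)
      (Measure.pi (fun _ : ι => gaussianReal 0 (Real.toNNReal (t - s)))) P
  continuous_paths : ∀ᵐ ω ∂P, ContinuousOn (fun t => W t ω) (Set.Icc 0 T)

/-- A deterministic step function `∑ k < m, c k • 1_{(t k, t (k+1)]}` with
`a ≤ t 0 ≤ t 1 ≤ ⋯ ≤ t m ≤ b`. -/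
structure StepFunction (a b : ℝ) where
  m : ℕ
  t : ℕ → ℝ
  c : ℕ → ℝ
  mono : Monotone t
  mem : ∀ k, t k ∈ Set.Icc a b

/-- The step function as a function of time. -/
def StepFunction.toFun {a b : ℝ} (φ : StepFunction a b) (s : ℝ) : ℝ :=
  ∑ k ∈ Finset.range φ.m, (Set.Ioc (φ.t k) (φ.t (k + 1))).indicator (fun _ => φ.c k) s

/-- The elementary stochastic integral of a step function against a real process `B`. -/
def StepFunction.integral {a b : ℝ} {Ω : Type*} (φ : StepFunction a b) (B : ℝ → Ω → ℝ)
    (ω : Ω) : ℝ :=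
  ∑ k ∈ Finset.range φ.m, φ.c k * (B (φ.t (k + 1)) ω - B (φ.t k) ω)

/-- `I` is (a version of) the stochastic integral `∫_a^b f(s) dB_s` of the deterministic function
`f`: the `L²(P)`-limit of the elementary integrals of step functions that converge
to `f` in `L²([a, b])`. -/
def IsWienerIntegral {Ω : Type*} [MeasurableSpace Ω] (P : Measure Ω) (B : ℝ → Ω → ℝ)
    (a b : ℝ) (f : ℝ → ℝ) (I : Ω → ℝ) : Prop :=
  MemLp I 2 P ∧ ∃ φ : ℕ → StepFunction a b,
    Tendsto (fun n => eLpNorm (fun s => (φ n).toFun s - f s) 2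
      (volume.restrict (Set.Icc a b))) atTop (𝓝 0) ∧
    Tendsto (fun n => eLpNorm (fun ω => (φ n).integral B ω - I ω) 2 P) atTop (𝓝 0)

/-- `I` is (a version of) the vector stochastic integral `∫_a^b G(s) dW_s` of the deterministic
matrix function `G`; its `i`-th entry is `∑ k, ∫_a^b G(s)_{ik} dW_{s,k}`. -/
def IsVectorWienerIntegral {Ω κ ι : Type*} [MeasurableSpace Ω] [Fintype ι] (P : Measure Ω)
    (W : ℝ → Ω → ι → ℝ) (a b : ℝ) (G : ℝ → Matrix κ ι ℝ) (I : Ω → κ → ℝ) : Prop :=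
  ∃ J : κ → ι → Ω → ℝ,
    (∀ i k, IsWienerIntegral P (fun t ω => W t ω k) a b (fun s => G s i k) (J i k)) ∧
    ∀ᵐ ω ∂P, ∀ i, I ω i = ∑ k, J i k ω

/-! ### The market model -/

/-- Parameters of the market: `N` assets and `N` futures, interest rate `r`, trading horizon `T`,
expiry dates `expiry i`, drift parameters, and the blocks of the volatility matrix. -/
structure Market (N : ℕ) where
  r : ℝ
  T : ℝ
  expiry : Fin N → ℝ
  muF : Fin N → ℝ
  muS : Fin N → ℝ
  etaF : Fin N → ℝ
  etaS : Fin N → ℝ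
  volF : Matrix (Fin N) (Fin N) ℝ
  volSF : Matrix (Fin N) (Fin N) ℝ
  volS : Matrix (Fin N) (Fin N) ℝ
  r_nonneg : 0 ≤ r
  T_pos : 0 < T
  T_lt_expiry : ∀ i, T < expiry i
  etaF_lt_etaS : ∀ i, etaF i < etaS i
  volF_lower : ∀ i j, i < j → volF i j = 0
  volS_lower : ∀ i j, i < j → volS i j = 0
  cov_posDef : (fromBlocks volF 0 volSF volS * (fromBlocks volF 0 volSF volS)ᵀ).PosDef

namespace Market

variable {N : ℕ} (A : Market N)

/-- The volatility matrix `Σ̃`; the index `inl i` is the `i`-th futures contract (or the `i`-th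
Brownian component), `inr i` is the `i`-th asset (or the `(N + i)`-th Brownian component). -/
def vol : Matrix (Fin N ⊕ Fin N) (Fin N ⊕ Fin N) ℝ := fromBlocks A.volF 0 A.volSF A.volS

/-- The instantaneous covariance matrix `Σ = Σ̃ Σ̃ᵀ`. -/
def cov : Matrix (Fin N ⊕ Fin N) (Fin N ⊕ Fin N) ℝ := A.vol * A.volᵀ

/-- The block `Σ_F` of `Σ`. -/
def covF : Matrix (Fin N) (Fin N) ℝ := A.cov.toBlocks₁₁

/-- The block `Σ_{FS}` of `Σ`. -/
def covFS : Matrix (Fin N) (Fin N) ℝ := A.cov.toBlocks₁₂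

/-- The block `Σ_S` of `Σ`. -/
def covS : Matrix (Fin N) (Fin N) ℝ := A.cov.toBlocks₂₂

/-- The volatility `σ_{i,F}` of the `i`-th futures contract. -/
def sigmaF (i : Fin N) : ℝ := Real.sqrt (A.cov (Sum.inl i) (Sum.inl i))

/-- The volatility `σ_{i,S}` of the `i`-th asset. -/
def sigmaS (i : Fin N) : ℝ := Real.sqrt (A.cov (Sum.inr i) (Sum.inr i))

/-- `κ_i = η_{i,S} - η_{i,F}`. -/
def kappa (i : Fin N) : ℝ := A.etaS i - A.etaF i

/-- `m_i = r + μ_{i,F} - μ_{i,S} - (σ_{i,F}² - σ_{i,S}²) / 2`. -/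
def m (i : Fin N) : ℝ :=
  A.r + A.muF i - A.muS i - 1 / 2 * (A.sigmaF i ^ 2 - A.sigmaS i ^ 2)

/-- `Σ̃_Z = [I_N, -I_N] Σ̃`. -/
def volZ : Matrix (Fin N) (Fin N ⊕ Fin N) ℝ :=
  (fromCols (1 : Matrix (Fin N) (Fin N) ℝ) (-1 : Matrix (Fin N) (Fin N) ℝ) :
    Matrix (Fin N) (Fin N ⊕ Fin N) ℝ) * A.vol

/-- `Σ_Z = Σ̃_Z Σ̃_Zᵀ`, with entries `β_{ij}`. -/
def covZ : Matrix (Fin N) (Fin N) ℝ := A.volZ * A.volZᵀ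

/-- The scaling factor `(T_i / (T_i - t)) ^ κ_i`. -/
def scale (i : Fin N) (t : ℝ) : ℝ := (A.expiry i / (A.expiry i - t)) ^ A.kappa i

/-- `Z` is the log-basis process driven by `W`, i.e. for every `t ∈ [0, T]`, almost surely,
`diag(scale i t) Z_t = Z_0 + ∫₀ᵗ diag(scale i s) m ds + ∫₀ᵗ diag(scale i s) Σ̃_Z dW_s`. -/
def IsLogBasis {Ω : Type*} [MeasurableSpace Ω] (P : Measure Ω)
    (W : ℝ → Ω → (Fin N ⊕ Fin N) → ℝ) (Z : ℝ → Ω → Fin N → ℝ) : Prop :=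
  ∀ t ∈ Set.Icc 0 A.T, ∃ I : Ω → Fin N → ℝ,
    IsVectorWienerIntegral P W 0 t
      (fun s => (diagonal (fun i => A.scale i s) : Matrix (Fin N) (Fin N) ℝ) * A.volZ) I ∧
    ∀ᵐ ω ∂P, ∀ i,
      A.scale i t * Z t ω i = Z 0 ω i + (∫ s in (0 : ℝ)..t, A.scale i s * A.m i) + I ω i

/-- The point `x T / M` of the uniform grid with `M` steps (used with `x = n` and `x = n - 1`). -/
def grid (M : ℕ) (x : ℝ) : ℝ := x * A.T / M

/-- The drift coefficient `φ_{n,i}`. -/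
def phi (M n : ℕ) (i : Fin N) : ℝ :=
  if A.kappa i = 1 then
    A.expiry i * Real.log
      ((A.expiry i - A.grid M ((n : ℝ) - 1)) / (A.expiry i - A.grid M n))
  else
    A.expiry i ^ A.kappa i / (A.kappa i - 1) *
      ((A.expiry i - A.grid M n) ^ (1 - A.kappa i)
        - (A.expiry i - A.grid M ((n : ℝ) - 1)) ^ (1 - A.kappa i))

/-- The error covariance `η_{ij;n}`. -/
def errorCov (M n : ℕ) (i j : Fin N) : ℝ :=
  A.covZ i j * ∫ s in A.grid M ((n : ℝ) - 1)..A.grid M n, A.scale i s * A.scale j s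

end Market

end FuturesBasis

end

noncomputable section

namespace FuturesBasis

/-! ### Closed spaces of centered Gaussian random variables -/

section GaussianSpace

open scoped NNReal ENNReal

variable {Ω : Type*} [MeasurableSpace Ω] {P : Measure Ω}

/-! Subtracting the log-basis equation at two consecutive grid points cancels `Z 0`, turns the drift
into an explicit integral of `scale` (which is `phi`), and leaves as error the increment of the
vector Wiener integral. Only the joint law of these increments needs work.

The centered Gaussian elements of L²(P) form a closed set, because laws are determined by
characteristic functions and these depend continuously on the L² element. Finite linear combinations
of Brownian values are centered Gaussian, hence so is every element of their closed span
(`gaussianSpace_subset`). Wiener integrals lie in this span as limits of elementary integrals. Any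
finite family from a linear space of Gaussians is jointly Gaussian
(`hasGaussianLaw_of_mem_submodule`), so independence of the errors reduces to vanishing covariances.

The covariances come from the Itô isometry, proved for step functions and carried to the limit by
continuity of inner products (`IsWienerIntegral.integral_mul`). Integrals up to times s and t have a
covariance depending only on min s t, so increments over different grid steps are uncorrelated
(`increment_cov`, `inner_increment`). -/

lemma integral_abs_sub_le_norm_sub [IsProbabilityMeasure P] (X Y : Lp ℝ 2 P) :
    ∫ ω, |X ω - Y ω| ∂P ≤ ‖X - Y‖ := by
  rw [Lp.norm_def]
  have h1 : ∫ ω, |X ω - Y ω| ∂P = (eLpNorm (⇑(X - Y)) 1 P).toReal := by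
    rw [eLpNorm_congr_ae (Lp.coeFn_sub X Y), eLpNorm_one_eq_lintegral_enorm,
      ← integral_norm_eq_lintegral_enorm ((Lp.aestronglyMeasurable X).sub (Lp.aestronglyMeasurable Y))]
    rfl
  rw [h1]
  exact ENNReal.toReal_mono (Lp.eLpNorm_ne_top _)
    (eLpNorm_le_eLpNorm_of_exponent_le (by norm_num) (Lp.aestronglyMeasurable _))

lemma norm_cexp_mul_I_sub_le (x y : ℝ) :
    ‖Complex.exp (x * Complex.I) - Complex.exp (y * Complex.I)‖ ≤ |x - y| := by
  have h : Complex.exp (x * Complex.I) - Complex.exp (y * Complex.I)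
      = Complex.exp (y * Complex.I) * (Complex.exp (Complex.I * ((x - y : ℝ) : ℂ)) - 1) := by
    rw [mul_sub, ← Complex.exp_add]
    push_cast
    ring_nf
  rw [h, norm_mul, Complex.norm_exp_ofReal_mul_I, one_mul]
  exact Real.norm_exp_I_mul_ofReal_sub_one_le

lemma integrable_cexp_mul_I [IsProbabilityMeasure P] {X : Ω → ℝ} (hX : AEMeasurable X P) :
    Integrable (fun ω => Complex.exp ((X ω : ℂ) * Complex.I)) P := by
  refine (integrable_const (1 : ℝ)).mono' ?_ ?_
  · exact (by fun_prop : AEMeasurable _ P).aestronglyMeasurable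
  · exact .of_forall fun ω => by simp [Complex.norm_exp_ofReal_mul_I]

lemma charFun_map_Lp (X : Lp ℝ 2 P) (t : ℝ) :
    charFun (P.map X) t = ∫ ω, Complex.exp (((t * X ω : ℝ) : ℂ) * Complex.I) ∂P := by
  rw [charFun_apply_real, integral_map (Lp.aestronglyMeasurable X).aemeasurable (by fun_prop)]
  push_cast
  rfl

/-- The function x ↦ exp(itx) is |t|-Lipschitz, and the L¹ norm is at most the L² norm for a
probability measure, so the map is |t|-Lipschitz. -/
lemma continuous_charFun_map_Lp [IsProbabilityMeasure P] (t : ℝ) :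
    Continuous fun X : Lp ℝ 2 P => charFun (P.map X) t := by
  have hL : LipschitzWith ⟨|t|, abs_nonneg t⟩ fun X : Lp ℝ 2 P => charFun (P.map X) t := by
    refine LipschitzWith.of_dist_le_mul fun X Y => ?_
    have hX := (Lp.aestronglyMeasurable X).aemeasurable
    have hY := (Lp.aestronglyMeasurable Y).aemeasurable
    rw [dist_eq_norm, dist_eq_norm, charFun_map_Lp, charFun_map_Lp,
      ← integral_sub (integrable_cexp_mul_I (hX.const_mul t)) (integrable_cexp_mul_I (hY.const_mul t))]
    have hint : Integrable (fun ω => |X ω - Y ω|) P :=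
      (((Lp.memLp X).integrable (by norm_num)).sub ((Lp.memLp Y).integrable (by norm_num))).abs
    calc _ ≤ ∫ ω, |t| * |X ω - Y ω| ∂P := by
          refine norm_integral_le_of_norm_le (hint.const_mul _) (.of_forall fun ω => ?_)
          refine (norm_cexp_mul_I_sub_le _ _).trans_eq ?_
          rw [← mul_sub, abs_mul]
      _ = |t| * ∫ ω, |X ω - Y ω| ∂P := integral_const_mul _ _
      _ ≤ |t| * ‖X - Y‖ := by gcongr; exact integral_abs_sub_le_norm_sub X Y
  exact hL.continuous

/-- The centered Gaussian elements of `L²(P)`. -/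
def centeredGaussian (P : Measure Ω) : Set (Lp ℝ 2 P) :=
  {X | P.map X = gaussianReal 0 (‖X‖₊ ^ 2)}

/-- The variance is tied to the L² norm, so for each t membership equates two continuous functions
of X: its characteristic function and the Gaussian one. -/
lemma isClosed_centeredGaussian [IsProbabilityMeasure P] : IsClosed (centeredGaussian P) := by
  have h : centeredGaussian P =
      ⋂ t : ℝ, {X : Lp ℝ 2 P | charFun (P.map X) t = Complex.exp (-((‖X‖ : ℂ) ^ 2 * t ^ 2 / 2))} := by
    ext X
    have hX := (Lp.aestronglyMeasurable X).aemeasurable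
    have := Measure.isProbabilityMeasure_map hX
    have key (t : ℝ) : charFun (gaussianReal 0 (‖X‖₊ ^ 2)) t
        = Complex.exp (-((‖X‖ : ℂ) ^ 2 * t ^ 2 / 2)) := by
      rw [charFun_gaussianReal]
      simp
    simp only [centeredGaussian, Set.mem_ofPred_eq, Set.mem_iInter]
    constructor
    · intro h t
      rw [h, key]
    · intro h
      refine Measure.ext_of_charFun (funext fun t => ?_)
      rw [h, key]
  rw [h]
  exact isClosed_iInter fun t => isClosed_eq (continuous_charFun_map_Lp t) (by fun_prop)

lemma topologicalClosure_subset_centeredGaussian [IsProbabilityMeasure P]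
    {F : Submodule ℝ (Lp ℝ 2 P)}
    (hF : (F : Set (Lp ℝ 2 P)) ⊆ centeredGaussian P) :
    (F.topologicalClosure : Set (Lp ℝ 2 P)) ⊆ centeredGaussian P :=
  closure_minimal hF isClosed_centeredGaussian

lemma mem_centeredGaussian_of_hasGaussianLaw {X : Ω → ℝ} (hX : HasGaussianLaw X P)
    (h0 : ∫ ω, X ω ∂P = 0) : hX.memLp_two.toLp X ∈ centeredGaussian P := by
  have hae := hX.memLp_two.coeFn_toLp
  simp only [centeredGaussian, Set.mem_ofPred_eq]
  rw [Measure.map_congr hae, hX.map_eq_gaussianReal, h0]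
  congr 1
  rw [← NNReal.coe_inj, NNReal.coe_pow, coe_nnnorm, Real.coe_toNNReal _ (variance_nonneg _ _),
    variance_of_integral_eq_zero hX.aemeasurable h0, ← real_inner_self_eq_norm_sq, L2.inner_def]
  refine integral_congr_ae ?_
  filter_upwards [hae] with ω hω
  rw [hω]
  simp [sq]

lemma integral_eq_zero_of_mem_centeredGaussian {X : Lp ℝ 2 P} (hX : X ∈ centeredGaussian P) :
    ∫ ω, X ω ∂P = 0 := by
  have h : HasLaw X (gaussianReal 0 (‖X‖₊ ^ 2)) P :=
    ⟨(Lp.aestronglyMeasurable X).aemeasurable, hX⟩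
  rw [h.integral_eq, integral_id_gaussianReal]

lemma hasGaussianLaw_of_forall_dual {E : Type*} [NormedAddCommGroup E] [NormedSpace ℝ E]
    [MeasurableSpace E] [BorelSpace E] {X : Ω → E} (hX : AEMeasurable X P)
    (h : ∀ L : StrongDual ℝ E, HasGaussianLaw (fun ω => L (X ω)) P) : HasGaussianLaw X P := by
  refine ⟨isGaussian_of_isGaussian_map fun L => ?_⟩
  rw [AEMeasurable.map_map_of_aemeasurable (by fun_prop) hX]
  exact (h L).isGaussian_map

/-- Cramér–Wold: a linear functional of the vector is a linear combination of its coordinates, which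
stays in `F` and is therefore Gaussian. -/
lemma hasGaussianLaw_of_mem_submodule {F : Submodule ℝ (Lp ℝ 2 P)}
    (hF : (F : Set (Lp ℝ 2 P)) ⊆ centeredGaussian P) {ι : Type*} [Fintype ι]
    {X : ι → Lp ℝ 2 P} (hX : ∀ i, X i ∈ F) : HasGaussianLaw (fun ω i => X i ω) P := by
  classical
  have hm (i : ι) : AEMeasurable (X i) P := (Lp.aestronglyMeasurable (X i)).aemeasurable
  refine hasGaussianLaw_of_forall_dual (by fun_prop) fun L => ?_
  let Y : Lp ℝ 2 P := ∑ i, L (Pi.single i 1) • X i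
  have hY : Y ∈ F := Submodule.sum_mem _ fun i _ => F.smul_mem _ (hX i)
  have hYG : HasGaussianLaw Y P := by
    constructor
    rw [show P.map Y = _ from hF hY]
    infer_instance
  refine hYG.congr ?_
  have h1 : ∀ᵐ ω ∂P, ∀ i, (L (Pi.single i 1) • X i) ω = L (Pi.single i 1) * X i ω := by
    rw [ae_all_iff]
    intro i
    filter_upwards [Lp.coeFn_smul (L (Pi.single i 1)) (X i)] with ω hω
    simp [hω]
  filter_upwards [Lp.coeFn_finsetSum Finset.univ fun i => L (Pi.single i 1) • X i, h1]
    with ω hω h1ω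
  rw [hω, Finset.sum_apply]
  conv_rhs => rw [← Finset.univ_sum_single (fun i => X i ω), map_sum]
  refine Finset.sum_congr rfl fun i _ => ?_
  rw [h1ω, mul_comm, ← smul_eq_mul, ← map_smul, ← Pi.single_smul, smul_eq_mul, mul_one]

end GaussianSpace

/-! ### Brownian motion as a Gaussian process -/

section Brownian

open scoped NNReal ENNReal

variable {Ω ι : Type*} [MeasurableSpace Ω] [Fintype ι] {P : Measure Ω}
  {T : ℝ} {W : ℝ → Ω → ι → ℝ}

lemma hasLaw_eval_pi_gaussianReal (v : ι → ℝ≥0) (i : ι) :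
    HasLaw (fun x : ι → ℝ => x i) (gaussianReal 0 (v i)) (Measure.pi fun i => gaussianReal 0 (v i)) :=
  ⟨(measurable_pi_apply i).aemeasurable,
    (measurePreserving_eval (fun i => gaussianReal 0 (v i)) i).map_eq⟩

lemma iIndepFun_eval_pi_gaussianReal (v : ι → ℝ≥0) :
    iIndepFun (fun (i : ι) (x : ι → ℝ) => x i) (Measure.pi fun i => gaussianReal 0 (v i)) :=
  iIndepFun_pi (X := fun _ x => x) fun _ => aemeasurable_id

lemma isGaussian_pi_gaussianReal (v : ι → ℝ≥0) :
    IsGaussian (Measure.pi fun i => gaussianReal 0 (v i)) := by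
  have := ((iIndepFun_eval_pi_gaussianReal v).hasGaussianLaw fun i =>
    (hasLaw_eval_pi_gaussianReal v i).hasGaussianLaw).isGaussian_map
  simpa using this

lemma integral_mul_pi_gaussianReal [DecidableEq ι] (v : ℝ≥0) (k l : ι) :
    ∫ x : ι → ℝ, x k * x l ∂(Measure.pi fun _ => gaussianReal 0 v)
      = if k = l then (v : ℝ) else 0 := by
  have hm (i : ι) := hasLaw_eval_pi_gaussianReal (fun _ : ι => v) i
  split_ifs with hkl
  · subst hkl
    have h := (hm k).integral_comp (f := fun y : ℝ => y * y) (by fun_prop)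
    refine h.trans ?_
    have hv := variance_fun_id_gaussianReal (μ := 0) (v := v)
    rw [variance_of_integral_eq_zero (by fun_prop) integral_id_gaussianReal] at hv
    simpa [sq] using hv
  · rw [((iIndepFun_eval_pi_gaussianReal fun _ : ι => v).indepFun hkl).integral_fun_mul_eq_mul_integral
      (hm k).aemeasurable.aestronglyMeasurable (hm l).aemeasurable.aestronglyMeasurable,
      (hm k).integral_eq, integral_id_gaussianReal, zero_mul]

namespace IsStdBrownian

lemma hasLaw (hW : IsStdBrownian T W P) {t : ℝ} (ht : t ∈ Set.Icc 0 T) :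
    HasLaw (W t) (Measure.pi fun _ : ι => gaussianReal 0 (Real.toNNReal t)) P := by
  have h := hW.law_increments 0 t le_rfl ht.1 ht.2
  rw [sub_zero] at h
  refine h.congr ?_
  filter_upwards [hW.start_zero] with ω hω
  simp [hω]

lemma hasGaussianLaw (hW : IsStdBrownian T W P) {t : ℝ} (ht : t ∈ Set.Icc 0 T) :
    HasGaussianLaw (W t) P := by
  have := isGaussian_pi_gaussianReal fun _ : ι => Real.toNNReal t
  exact (hW.hasLaw ht).hasGaussianLaw

lemma isGaussianProcess (hW : IsStdBrownian T W P) (hT : 0 ≤ T) :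
    IsGaussianProcess (fun p : Set.Icc (0 : ℝ) T × ι => fun ω => W p.1 ω p.2) P := by
  have : Fact (0 ≤ T) := ⟨hT⟩
  have h : IsGaussianProcess (fun (t : Set.Icc (0 : ℝ) T) => W t) P :=
    HasIndepIncrements.isGaussianProcess (fun t => hW.hasGaussianLaw t.2)
      (by simpa using hW.start_zero) hW.indep_increments
  classical
  refine ⟨fun I => ?_⟩
  -- A finite set of (time, coordinate) pairs is a linear image of the full vectors at the finitely
  -- many times involved.
  exact (h.hasGaussianLaw (I.image Prod.fst)).map (ContinuousLinearMap.pi fun p : I =>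
    ContinuousLinearMap.proj (R := ℝ) (φ := fun _ : ι => ℝ) p.1.2 ∘L
      ContinuousLinearMap.proj
        (⟨p.1.1, Finset.mem_image_of_mem _ p.2⟩ : (I.image Prod.fst : Finset _)))

lemma memLp (hW : IsStdBrownian T W P) {t : ℝ} (ht : t ∈ Set.Icc 0 T) (k : ι) :
    MemLp (fun ω => W t ω k) 2 P :=
  ((hW.hasGaussianLaw ht).eval (X := fun k ω => W t ω k) k).memLp_two

lemma integral_eq_zero (hW : IsStdBrownian T W P) {t : ℝ} (ht : t ∈ Set.Icc 0 T) (k : ι) :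
    ∫ ω, W t ω k ∂P = 0 := by
  have h := (hasLaw_eval_pi_gaussianReal (fun _ : ι => t.toNNReal) k).comp (hW.hasLaw ht)
  exact h.integral_eq.trans integral_id_gaussianReal

lemma integral_mul_of_le [DecidableEq ι] (hW : IsStdBrownian T W P) {s t : ℝ} (hs : 0 ≤ s)
    (hst : s ≤ t) (ht : t ≤ T) (k l : ι) :
    ∫ ω, W s ω k * W t ω l ∂P = if k = l then s else 0 := by
  have hs' : s ∈ Set.Icc 0 T := ⟨hs, hst.trans ht⟩
  have ht' : t ∈ Set.Icc 0 T := ⟨hs.trans hst, ht⟩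
  have hT : 0 ≤ T := (hs.trans hst).trans ht
  have : Fact (0 ≤ T) := ⟨hT⟩
  -- The bottom of the time interval is 0, where W vanishes almost surely, so W s is itself an
  -- increment.
  have hind : IndepFun (W s) (W t - W s) P :=
    hW.indep_increments.indepFun_eval_sub (r := ⊥) (s := ⟨s, hs'⟩) (t := ⟨t, ht'⟩) bot_le
      (Subtype.mk_le_mk.2 hst) (by simpa using hW.start_zero)
  have hind' : IndepFun (fun ω => W s ω k) (fun ω => W t ω l - W s ω l) P :=
    hind.comp (φ := fun x : ι → ℝ => x k) (ψ := fun x : ι → ℝ => x l) (by fun_prop) (by fun_prop)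
  have h1 : ∫ ω, W s ω k * (W t ω l - W s ω l) ∂P = 0 := by
    rw [hind'.integral_fun_mul_eq_mul_integral (hW.memLp hs' k).1
      ((hW.memLp ht' l).sub (hW.memLp hs' l)).1, hW.integral_eq_zero hs' k, zero_mul]
  have h2 : ∫ ω, W s ω k * W s ω l ∂P = if k = l then s else 0 := by
    have h := (hW.hasLaw hs').integral_comp (f := fun x : ι → ℝ => x k * x l) (by fun_prop)
    refine h.trans ?_
    rw [integral_mul_pi_gaussianReal, Real.coe_toNNReal _ hs]
  have i1 : Integrable (fun ω => W s ω k * (W t ω l - W s ω l)) P :=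
    (hW.memLp hs' k).integrable_mul ((hW.memLp ht' l).sub (hW.memLp hs' l))
  have i2 : Integrable (fun ω => W s ω k * W s ω l) P :=
    (hW.memLp hs' k).integrable_mul (hW.memLp hs' l)
  rw [← h2, ← zero_add (∫ ω, W s ω k * W s ω l ∂P), ← h1, ← integral_add i1 i2]
  congr 1 with ω
  ring

lemma integral_mul [DecidableEq ι] (hW : IsStdBrownian T W P) {s t : ℝ} (hs : s ∈ Set.Icc 0 T)
    (ht : t ∈ Set.Icc 0 T) (k l : ι) :
    ∫ ω, W s ω k * W t ω l ∂P = if k = l then min s t else 0 := by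
  rcases le_total s t with h | h
  · rw [hW.integral_mul_of_le hs.1 h ht.2, min_eq_left h]
  · simp_rw [mul_comm (W s _ k)]
    rw [hW.integral_mul_of_le ht.1 h hs.2, min_eq_right h]
    simp only [eq_comm]

/-- Expanding the product gives a signed sum of four minima equal to the overlap length. As a volume
of an intersection, it matches the integral of a product of indicators. -/
lemma integral_increment_mul_increment [DecidableEq ι] (hW : IsStdBrownian T W P)
    {a b c d : ℝ} (ha : a ∈ Set.Icc 0 T) (hb : b ∈ Set.Icc 0 T) (hc : c ∈ Set.Icc 0 T)
    (hd : d ∈ Set.Icc 0 T) (hab : a ≤ b) (hcd : c ≤ d) (k l : ι) :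
    ∫ ω, (W b ω k - W a ω k) * (W d ω l - W c ω l) ∂P
      = if k = l then volume.real (Set.Ioc a b ∩ Set.Ioc c d) else 0 := by
  have i {s t : ℝ} (hs : s ∈ Set.Icc 0 T) (ht : t ∈ Set.Icc 0 T) :
      Integrable (fun ω => W s ω k * W t ω l) P :=
    (hW.memLp hs k).integrable_mul (hW.memLp ht l)
  have h : ∫ ω, (W b ω k - W a ω k) * (W d ω l - W c ω l) ∂P
      = ∫ ω, (W b ω k * W d ω l - W b ω k * W c ω l)
        - (W a ω k * W d ω l - W a ω k * W c ω l) ∂P := by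
    congr 1 with ω
    ring
  rw [h, integral_sub (by exact (i hb hd).sub (i hb hc)) (by exact (i ha hd).sub (i ha hc)),
    integral_sub (i hb hd) (i hb hc), integral_sub (i ha hd) (i ha hc),
    hW.integral_mul hb hd, hW.integral_mul hb hc, hW.integral_mul ha hd, hW.integral_mul ha hc]
  split_ifs
  · rw [Set.Ioc_inter_Ioc, Real.volume_real_Ioc]
    grind
  · simp

/-- The closed linear span in `L²(P)` of the values of the Brownian motion `W`. -/
def gaussianSpace (hW : IsStdBrownian T W P) : Submodule ℝ (Lp ℝ 2 P) :=
  (Submodule.span ℝ (Set.range fun p : Set.Icc (0 : ℝ) T × ι =>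
    (hW.memLp p.1.2 p.2).toLp)).topologicalClosure

lemma gaussianSpace_subset [IsProbabilityMeasure P] (hW : IsStdBrownian T W P) (hT : 0 ≤ T) :
    (hW.gaussianSpace : Set (Lp ℝ 2 P)) ⊆ centeredGaussian P := by
  refine topologicalClosure_subset_centeredGaussian ?_
  intro X hX
  obtain ⟨c, rfl⟩ := Finsupp.mem_span_range_iff_exists_finsupp.1 hX
  have hG : HasGaussianLaw (fun ω => ∑ p ∈ c.support, c p • W p.1 ω p.2) P :=
    ((hW.isGaussianProcess hT).smul c).hasGaussianLaw_fun_sum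
  have h0 : ∫ ω, ∑ p ∈ c.support, c p • W p.1 ω p.2 ∂P = 0 := by
    rw [integral_finsetSum _ fun p _ => by
      exact ((hW.memLp p.1.2 p.2).integrable (by norm_num)).smul (c p)]
    refine Finset.sum_eq_zero fun p _ => ?_
    rw [integral_smul, hW.integral_eq_zero p.1.2, smul_zero]
  have h := mem_centeredGaussian_of_hasGaussianLaw hG h0
  convert h
  rw [Lp.ext_iff]
  have h1 : ∀ᵐ ω ∂P, ∀ p ∈ c.support,
      (c p • (hW.memLp p.1.2 p.2).toLp) ω = c p • W p.1 ω p.2 := by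
    rw [Filter.eventually_all_finset]
    intro p _
    filter_upwards [Lp.coeFn_smul (c p) ((hW.memLp p.1.2 p.2).toLp),
      (hW.memLp p.1.2 p.2).coeFn_toLp] with ω h1 h2
    rw [h1, Pi.smul_apply, h2]
  filter_upwards [hG.memLp_two.coeFn_toLp, h1,
    Lp.coeFn_finsetSum c.support fun p => c p • (hW.memLp p.1.2 p.2).toLp] with ω h2 h3 h4
  rw [h2, Finsupp.sum, h4, Finset.sum_apply]
  exact Finset.sum_congr rfl h3

end IsStdBrownian

end Brownian

/-! ### Wiener integrals -/

section Wiener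

variable {Ω ι : Type*} [MeasurableSpace Ω] [Fintype ι] {P : Measure Ω}
  {T : ℝ} {W : ℝ → Ω → ι → ℝ}

lemma inner_toLp_eq_integral_mul {α : Type*} [MeasurableSpace α] {μ : Measure α} {f g : α → ℝ}
    (hf : MemLp f 2 μ) (hg : MemLp g 2 μ) :
    inner ℝ (hf.toLp f) (hg.toLp g) = ∫ x, f x * g x ∂μ := by
  rw [L2.inner_def]
  refine integral_congr_ae ?_
  filter_upwards [hf.coeFn_toLp, hg.coeFn_toLp] with x h1 h2
  rw [h1, h2]
  simp [mul_comm]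

namespace StepFunction

variable {a b c d : ℝ}

lemma memLp_toFun (φ : StepFunction a b) : MemLp φ.toFun 2 volume := by
  unfold toFun
  exact memLp_finsetSum _ fun k _ => memLp_indicator_const 2 measurableSet_Ioc _
    (Or.inr (by simp))

lemma toFun_eq_zero (φ : StepFunction a b) {s : ℝ} (hs : s ∉ Set.Icc a b) : φ.toFun s = 0 := by
  refine Finset.sum_eq_zero fun k _ => Set.indicator_of_notMem (fun h => hs ?_) _
  exact ⟨(φ.mem k).1.trans h.1.le, h.2.trans (φ.mem (k + 1)).2⟩

lemma memLp_integral (hW : IsStdBrownian T W P) {t : ℝ} (ht : t ≤ T) (φ : StepFunction 0 t)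
    (k : ι) : MemLp (φ.integral fun t ω => W t ω k) 2 P := by
  have hmem (j : ℕ) : φ.t j ∈ Set.Icc 0 T := ⟨(φ.mem j).1, (φ.mem j).2.trans ht⟩
  unfold StepFunction.integral
  exact memLp_finsetSum _ fun j _ =>
    ((hW.memLp (hmem (j + 1)) k).sub (hW.memLp (hmem j) k)).const_mul _

lemma toLp_integral_mem (hW : IsStdBrownian T W P) {t : ℝ} (ht : t ≤ T) (φ : StepFunction 0 t)
    (k : ι) : (φ.memLp_integral hW ht k).toLp ∈ hW.gaussianSpace := by
  have hmem (j : ℕ) : φ.t j ∈ Set.Icc 0 T := ⟨(φ.mem j).1, (φ.mem j).2.trans ht⟩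
  have hinc (j : ℕ) : MemLp (fun ω => φ.c j * (W (φ.t (j + 1)) ω k - W (φ.t j) ω k)) 2 P :=
    ((hW.memLp (hmem (j + 1)) k).sub (hW.memLp (hmem j) k)).const_mul _
  have hW' (j : ℕ) : (hW.memLp (hmem j) k).toLp ∈ hW.gaussianSpace :=
    Submodule.le_topologicalClosure _ (Submodule.subset_span ⟨(⟨φ.t j, hmem j⟩, k), rfl⟩)
  have h : (φ.memLp_integral hW ht k).toLp = ∑ j ∈ Finset.range φ.m,
      φ.c j • ((hW.memLp (hmem (j + 1)) k).toLp - (hW.memLp (hmem j) k).toLp) := by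
    rw [Lp.ext_iff]
    have h1 : ∀ᵐ ω ∂P, ∀ j ∈ Finset.range φ.m,
        (φ.c j • ((hW.memLp (hmem (j + 1)) k).toLp - (hW.memLp (hmem j) k).toLp)) ω
          = φ.c j * (W (φ.t (j + 1)) ω k - W (φ.t j) ω k) := by
      rw [Filter.eventually_all_finset]
      intro j _
      rw [← MemLp.toLp_sub, ← MemLp.toLp_const_smul]
      exact MemLp.coeFn_toLp _
    filter_upwards [(φ.memLp_integral hW ht k).coeFn_toLp, h1,
      Lp.coeFn_finsetSum (Finset.range φ.m) fun j =>
        φ.c j • ((hW.memLp (hmem (j + 1)) k).toLp - (hW.memLp (hmem j) k).toLp)] with ω h2 h3 h4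
    rw [h2, h4, Finset.sum_apply]
    exact (Finset.sum_congr rfl h3).symm
  rw [h]
  exact Submodule.sum_mem _ fun j _ => Submodule.smul_mem _ _ (Submodule.sub_mem _ (hW' _) (hW' _))

/-- Polarized Itô isometry: both sides expand into the same double sum of overlap lengths.
Integrating over the whole line accommodates two different horizons. -/
lemma integral_mul_integral [DecidableEq ι] (hW : IsStdBrownian T W P) {s t : ℝ} (hs : s ≤ T)
    (ht : t ≤ T) (φ : StepFunction 0 s) (ψ : StepFunction 0 t) (k l : ι) :
    ∫ ω, φ.integral (fun t ω => W t ω k) ω * ψ.integral (fun t ω => W t ω l) ω ∂P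
      = if k = l then ∫ u, φ.toFun u * ψ.toFun u else 0 := by
  have hφ (j : ℕ) : φ.t j ∈ Set.Icc 0 T := ⟨(φ.mem j).1, (φ.mem j).2.trans hs⟩
  have hψ (j : ℕ) : ψ.t j ∈ Set.Icc 0 T := ⟨(ψ.mem j).1, (ψ.mem j).2.trans ht⟩
  have h1 : ∫ ω, φ.integral (fun t ω => W t ω k) ω * ψ.integral (fun t ω => W t ω l) ω ∂P
      = ∑ i ∈ Finset.range φ.m, ∑ j ∈ Finset.range ψ.m, φ.c i * ψ.c j *
        if k = l then volume.real
          (Set.Ioc (φ.t i) (φ.t (i + 1)) ∩ Set.Ioc (ψ.t j) (ψ.t (j + 1))) else 0 := by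
    have hint (i j : ℕ) : Integrable (fun ω => (W (φ.t (i + 1)) ω k - W (φ.t i) ω k) *
        (W (ψ.t (j + 1)) ω l - W (ψ.t j) ω l)) P :=
      ((hW.memLp (hφ (i + 1)) k).sub (hW.memLp (hφ i) k)).integrable_mul
        ((hW.memLp (hψ (j + 1)) l).sub (hW.memLp (hψ j) l))
    have hcomm (i j : ℕ) (ω : Ω) : φ.c i * (W (φ.t (i + 1)) ω k - W (φ.t i) ω k) *
        (ψ.c j * (W (ψ.t (j + 1)) ω l - W (ψ.t j) ω l)) = φ.c i * ψ.c j *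
        ((W (φ.t (i + 1)) ω k - W (φ.t i) ω k) * (W (ψ.t (j + 1)) ω l - W (ψ.t j) ω l)) :=
      mul_mul_mul_comm _ _ _ _
    simp_rw [StepFunction.integral, Finset.sum_mul_sum, hcomm]
    rw [integral_finsetSum _ fun i _ => integrable_finsetSum _ fun j _ => (hint i j).const_mul _]
    refine Finset.sum_congr rfl fun i _ => ?_
    rw [integral_finsetSum _ fun j _ => (hint i j).const_mul _]
    refine Finset.sum_congr rfl fun j _ => ?_
    rw [integral_const_mul, hW.integral_increment_mul_increment (hφ _) (hφ _) (hψ _) (hψ _)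
      (φ.mono (Nat.le_succ i)) (ψ.mono (Nat.le_succ j))]
  rw [h1]
  split_ifs
  · have hprod (i j : ℕ) : (fun u => (Set.Ioc (φ.t i) (φ.t (i + 1))).indicator (fun _ => φ.c i) u *
        (Set.Ioc (ψ.t j) (ψ.t (j + 1))).indicator (fun _ => ψ.c j) u)
        = (Set.Ioc (φ.t i) (φ.t (i + 1)) ∩ Set.Ioc (ψ.t j) (ψ.t (j + 1))).indicator
          (fun _ => φ.c i * ψ.c j) := by
      funext u
      rw [← Set.inter_indicator_mul]
    have hint (i j : ℕ) : Integrable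
        (fun u => (Set.Ioc (φ.t i) (φ.t (i + 1))).indicator (fun _ => φ.c i) u *
          (Set.Ioc (ψ.t j) (ψ.t (j + 1))).indicator (fun _ => ψ.c j) u) := by
      rw [hprod, integrable_indicator_iff (measurableSet_Ioc.inter measurableSet_Ioc)]
      exact integrableOn_const (ne_top_of_le_ne_top (by simp) (measure_mono Set.inter_subset_left))
    simp_rw [StepFunction.toFun, Finset.sum_mul_sum]
    rw [integral_finsetSum _ fun i _ => integrable_finsetSum _ fun j _ => hint i j]
    refine Finset.sum_congr rfl fun i _ => ?_
    rw [integral_finsetSum _ fun j _ => hint i j]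
    refine Finset.sum_congr rfl fun j _ => ?_
    rw [hprod, integral_indicator_const _ (measurableSet_Ioc.inter measurableSet_Ioc), smul_eq_mul,
      mul_comm]
  · simp

end StepFunction

namespace IsWienerIntegral

/-- Extension by zero puts integrands with different horizons into the single Hilbert space L²(ℝ),
where their inner products can be compared. -/
lemma exists_tendsto (hW : IsStdBrownian T W P) {t : ℝ} (ht : t ≤ T) {k : ι} {f : ℝ → ℝ}
    {I : Ω → ℝ} (hI : IsWienerIntegral P (fun t ω => W t ω k) 0 t f I)
    (hf : MemLp ((Set.Icc 0 t).indicator f) 2 volume) :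
    ∃ φ : ℕ → StepFunction 0 t,
      Tendsto (fun n => (φ n).memLp_toFun.toLp) atTop (𝓝 hf.toLp) ∧
      Tendsto (fun n => ((φ n).memLp_integral hW ht k).toLp) atTop (𝓝 hI.1.toLp) := by
  obtain ⟨hI2, φ, hφf, hφI⟩ := hI
  refine ⟨φ, ?_, ?_⟩
  · rw [Lp.tendsto_Lp_iff_tendsto_eLpNorm'']
    convert hφf using 2 with n
    rw [← eLpNorm_indicator_eq_eLpNorm_restrict measurableSet_Icc]
    congr 1
    ext s
    by_cases hs : s ∈ Set.Icc 0 t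
    · simp [hs]
    · simp [hs, (φ n).toFun_eq_zero hs]
  · rw [Lp.tendsto_Lp_iff_tendsto_eLpNorm'']
    exact hφI

lemma toLp_mem_gaussianSpace (hW : IsStdBrownian T W P) {t : ℝ} (ht : t ≤ T) {k : ι} {f : ℝ → ℝ}
    {I : Ω → ℝ} (hI : IsWienerIntegral P (fun t ω => W t ω k) 0 t f I)
    (hf : MemLp ((Set.Icc 0 t).indicator f) 2 volume) : hI.1.toLp ∈ hW.gaussianSpace := by
  obtain ⟨φ, -, h⟩ := hI.exists_tendsto hW ht hf
  exact (Submodule.isClosed_topologicalClosure _).mem_of_tendsto h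
    (.of_forall fun n => (φ n).toLp_integral_mem hW ht k)

lemma integral_mul [DecidableEq ι] (hW : IsStdBrownian T W P) {s t : ℝ} (hs : s ∈ Set.Icc 0 T)
    (ht : t ∈ Set.Icc 0 T) {k l : ι} {f g : ℝ → ℝ} {I J : Ω → ℝ}
    (hI : IsWienerIntegral P (fun t ω => W t ω k) 0 s f I)
    (hJ : IsWienerIntegral P (fun t ω => W t ω l) 0 t g J)
    (hf : MemLp ((Set.Icc 0 s).indicator f) 2 volume)
    (hg : MemLp ((Set.Icc 0 t).indicator g) 2 volume) :
    ∫ ω, I ω * J ω ∂P = if k = l then ∫ u in (0 : ℝ)..min s t, f u * g u else 0 := by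
  obtain ⟨φ, hφf, hφI⟩ := hI.exists_tendsto hW hs.2 hf
  obtain ⟨ψ, hψg, hψJ⟩ := hJ.exists_tendsto hW ht.2 hg
  -- The isometry identifies the two sequences of inner products (when `k = l`), so their limits
  -- agree.
  have h1 := hφI.inner (𝕜 := ℝ) hψJ
  have h2 := hφf.inner (𝕜 := ℝ) hψg
  simp_rw [inner_toLp_eq_integral_mul, StepFunction.integral_mul_integral hW hs.2 ht.2] at h1
  simp_rw [inner_toLp_eq_integral_mul] at h2
  split_ifs with hkl
  · simp only [hkl, if_true] at h1
    rw [tendsto_nhds_unique h1 h2, intervalIntegral.integral_of_le (le_min hs.1 ht.1),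
      ← integral_Icc_eq_integral_Ioc, ← integral_indicator measurableSet_Icc]
    congr 1 with u
    rw [← Set.inter_indicator_mul, Set.Icc_inter_Icc, sup_idem]
  · simp only [hkl, if_false] at h1
    exact tendsto_nhds_unique h1 tendsto_const_nhds

end IsWienerIntegral

end Wiener

namespace Market

variable {N : ℕ} (A : Market N)

/-! ### Deterministic coefficients of the log-basis process -/

lemma covZ_eq : A.covZ = A.covF + A.covS - A.covFS - A.covFSᵀ := by
  have hsymm : A.cov.toBlocks₂₁ = A.covFSᵀ := by
    ext i j
    simp only [covFS, toBlocks₂₁, toBlocks₁₂, cov, mul_apply, transpose_apply, of_apply]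
    exact Finset.sum_congr rfl fun k _ => mul_comm _ _
  have h : A.covZ = (fromCols 1 (-1) : Matrix (Fin N) (Fin N ⊕ Fin N) ℝ) * A.cov *
      (fromCols 1 (-1) : Matrix (Fin N) (Fin N ⊕ Fin N) ℝ)ᵀ := by
    simp only [covZ, volZ, cov, transpose_mul, Matrix.mul_assoc]
  rw [h, ← fromBlocks_toBlocks A.cov, transpose_fromCols, fromCols_mul_fromBlocks,
    fromCols_mul_fromRows, hsymm]
  simp only [Matrix.one_mul, transpose_one, Matrix.mul_one, transpose_neg, Matrix.neg_mul,
    Matrix.mul_neg]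
  change A.covF + -A.covFSᵀ + -(A.covFS + -A.covS) = _
  abel

variable {A}

lemma sub_pos_of_mem {t : ℝ} (ht : t ∈ Set.Icc 0 A.T) (i : Fin N) : 0 < A.expiry i - t :=
  sub_pos.2 (ht.2.trans_lt (A.T_lt_expiry i))

lemma expiry_pos (i : Fin N) : 0 < A.expiry i := A.T_pos.trans (A.T_lt_expiry i)

lemma continuousOn_scale (i : Fin N) : ContinuousOn (A.scale i) (Set.Icc 0 A.T) := by
  have h : ContinuousOn (fun t => A.expiry i / (A.expiry i - t)) (Set.Icc 0 A.T) :=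
    continuousOn_const.div (by fun_prop) fun t ht => (sub_pos_of_mem ht i).ne'
  exact h.rpow_const fun t ht => Or.inl (div_pos (expiry_pos i) (sub_pos_of_mem ht i)).ne'

lemma intervalIntegrable_of_continuousOn {f : ℝ → ℝ} (hf : ContinuousOn f (Set.Icc 0 A.T))
    {a b : ℝ} (ha : a ∈ Set.Icc 0 A.T) (hb : b ∈ Set.Icc 0 A.T) :
    IntervalIntegrable f volume a b :=
  (hf.mono (Set.ordConnected_Icc.uIcc_subset ha hb)).intervalIntegrable

lemma memLp_indicator_scale (i : Fin N) (k : Fin N ⊕ Fin N) {t : ℝ} (ht : t ∈ Set.Icc 0 A.T) :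
    MemLp ((Set.Icc 0 t).indicator fun s => A.scale i s * A.volZ i k) 2 volume := by
  rw [memLp_indicator_iff_restrict measurableSet_Icc]
  have hc : ContinuousOn (fun s => A.scale i s * A.volZ i k) (Set.Icc 0 t) :=
    ((continuousOn_scale i).mono (Set.Icc_subset_Icc_right ht.2)).mul continuousOn_const
  obtain ⟨C, hC⟩ := isCompact_Icc.exists_bound_of_continuousOn hc
  exact MemLp.of_bound (hc.aestronglyMeasurable measurableSet_Icc) C
    ((ae_restrict_iff' measurableSet_Icc).2 (.of_forall hC))

lemma integral_scale_of_kappa_eq_one {i : Fin N} (hκ : A.kappa i = 1) {a b : ℝ}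
    (ha : a ∈ Set.Icc 0 A.T) (hb : b ∈ Set.Icc 0 A.T) :
    ∫ s in a..b, A.scale i s
      = A.expiry i * Real.log ((A.expiry i - a) / (A.expiry i - b)) := by
  have hd : ∀ s ∈ Set.uIcc a b,
      HasDerivAt (fun s => -(A.expiry i * Real.log (A.expiry i - s))) (A.scale i s) s := by
    intro s hs
    have hpos := sub_pos_of_mem (Set.ordConnected_Icc.uIcc_subset ha hb hs) i
    have h := ((((hasDerivAt_id s).const_sub (A.expiry i)).log hpos.ne').const_mul
      (A.expiry i)).neg
    refine HasDerivAt.congr_deriv h ?_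
    simp only [scale, hκ, Real.rpow_one, id]
    ring
  rw [intervalIntegral.integral_eq_sub_of_hasDerivAt hd
    (intervalIntegrable_of_continuousOn (continuousOn_scale i) ha hb),
    Real.log_div (sub_pos_of_mem ha i).ne' (sub_pos_of_mem hb i).ne']
  ring

lemma integral_scale_of_kappa_ne_one {i : Fin N} (hκ : A.kappa i ≠ 1) {a b : ℝ}
    (ha : a ∈ Set.Icc 0 A.T) (hb : b ∈ Set.Icc 0 A.T) :
    ∫ s in a..b, A.scale i s = A.expiry i ^ A.kappa i / (A.kappa i - 1) *
      ((A.expiry i - b) ^ (1 - A.kappa i) - (A.expiry i - a) ^ (1 - A.kappa i)) := by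
  have hκ' : A.kappa i - 1 ≠ 0 := sub_ne_zero.2 hκ
  have hd : ∀ s ∈ Set.uIcc a b,
      HasDerivAt (fun s => A.expiry i ^ A.kappa i / (A.kappa i - 1) *
        (A.expiry i - s) ^ (1 - A.kappa i)) (A.scale i s) s := by
    intro s hs
    have hpos := sub_pos_of_mem (Set.ordConnected_Icc.uIcc_subset ha hb hs) i
    have h := (((hasDerivAt_id s).const_sub (A.expiry i)).rpow_const (p := 1 - A.kappa i)
      (Or.inl hpos.ne')).const_mul (A.expiry i ^ A.kappa i / (A.kappa i - 1))
    refine HasDerivAt.congr_deriv h ?_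
    simp only [scale, id]
    rw [Real.div_rpow (expiry_pos i).le hpos.le, show 1 - A.kappa i - 1 = -A.kappa i by ring,
      Real.rpow_neg hpos.le]
    field_simp
    ring
  rw [intervalIntegral.integral_eq_sub_of_hasDerivAt hd
    (intervalIntegrable_of_continuousOn (continuousOn_scale i) ha hb)]
  ring

lemma grid_mem {M n : ℕ} (hM : 0 < M) (hn : n ≤ M) : A.grid M n ∈ Set.Icc 0 A.T := by
  have hM' : (0 : ℝ) < M := by exact_mod_cast hM
  have hT := A.T_pos
  have hn' : (n : ℝ) ≤ M := by exact_mod_cast hn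
  refine ⟨by unfold grid; positivity, ?_⟩
  rw [grid, div_le_iff₀ hM']
  nlinarith

lemma grid_mono (M : ℕ) : Monotone fun n : ℕ => A.grid M n := by
  intro n m h
  have hT := A.T_pos
  simp only [grid]
  gcongr

lemma integral_scale_eq_phi {M n : ℕ} (hM : 0 < M) (hn : n + 1 ≤ M) (i : Fin N) :
    ∫ s in A.grid M n..A.grid M (n + 1 : ℕ), A.scale i s = A.phi M (n + 1) i := by
  have ha := grid_mem (A := A) hM ((Nat.le_succ n).trans hn)
  have hb := grid_mem (A := A) hM hn
  have h : ((n + 1 : ℕ) : ℝ) - 1 = n := by push_cast; ring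
  unfold phi
  rw [h]
  split_ifs with hκ
  · exact integral_scale_of_kappa_eq_one hκ ha hb
  · exact integral_scale_of_kappa_ne_one hκ ha hb

/-- The covariance of two grid increments of a process with covariance `G (min s t)`. -/
lemma increment_cov {t : ℕ → ℝ} (ht : Monotone t) (G : ℝ → ℝ) (n m : ℕ) :
    G (min (t (n + 1)) (t (m + 1))) - G (min (t (n + 1)) (t m))
      - (G (min (t n) (t (m + 1))) - G (min (t n) (t m)))
      = if n = m then G (t (n + 1)) - G (t n) else 0 := by
  split_ifs with h
  · subst h
    simp [ht (Nat.le_succ n)]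
  -- Different grid steps do not overlap, so each minimum is decided by the earlier step and the
  -- terms cancel in pairs.
  · rcases lt_or_gt_of_ne h with h | h
    · rw [min_eq_left (ht (by omega)), min_eq_left (ht (by omega)), min_eq_left (ht (by omega)),
        min_eq_left (ht (by omega))]
      ring
    · rw [min_eq_right (ht (by omega)), min_eq_right (ht (by omega)),
        min_eq_right (ht (by omega)), min_eq_right (ht (by omega))]
      ring

end Market

namespace Market

variable {N : ℕ} {A : Market N}

/-! ### The increments of the stochastic integral on the grid -/

section Increments

variable {Ω : Type*} [MeasurableSpace Ω] {P : Measure Ω} {W : ℝ → Ω → (Fin N ⊕ Fin N) → ℝ}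
  {M : ℕ} {J : ℕ → Fin N → Fin N ⊕ Fin N → Ω → ℝ}

/-- The element of `L²(P)` given by the increment from the grid point `n` to the grid point `n + 1`
of a process whose `i`-th component is `∑ k, J n i k`. -/
def increment (hJ : ∀ n ≤ M, ∀ i k, MemLp (J n i k) 2 P) (n : ℕ) (hn : n + 1 ≤ M) (i : Fin N) :
    Lp ℝ 2 P :=
  ∑ k, ((hJ (n + 1) hn i k).toLp - (hJ n ((Nat.le_succ n).trans hn) i k).toLp)

lemma increment_ae_eq (hJ : ∀ n ≤ M, ∀ i k, MemLp (J n i k) 2 P) (n : ℕ) (hn : n + 1 ≤ M)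
    (i : Fin N) :
    ∀ᵐ ω ∂P, increment hJ n hn i ω = ∑ k, J (n + 1) i k ω - ∑ k, J n i k ω := by
  have h1 : ∀ᵐ ω ∂P, ∀ k, ((hJ (n + 1) hn i k).toLp - (hJ n ((Nat.le_succ n).trans hn) i k).toLp) ω
      = J (n + 1) i k ω - J n i k ω := by
    rw [ae_all_iff]
    intro k
    rw [← MemLp.toLp_sub]
    exact MemLp.coeFn_toLp _
  filter_upwards [h1, Lp.coeFn_finsetSum Finset.univ fun k =>
    ((hJ (n + 1) hn i k).toLp - (hJ n ((Nat.le_succ n).trans hn) i k).toLp)] with ω h1 h2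
  rw [increment, h2, Finset.sum_apply, ← Finset.sum_sub_distrib]
  exact Finset.sum_congr rfl fun k _ => h1 k

lemma increment_mem_gaussianSpace (hW : IsStdBrownian A.T W P) (hM : 0 < M)
    (hJ : ∀ n ≤ M, ∀ i k, IsWienerIntegral P (fun t ω => W t ω k) 0 (A.grid M n)
      (fun s => A.scale i s * A.volZ i k) (J n i k))
    (n : ℕ) (hn : n + 1 ≤ M) (i : Fin N) :
    increment (fun n hn i k => (hJ n hn i k).1) n hn i ∈ hW.gaussianSpace := by
  have h (n : ℕ) (hn : n ≤ M) (k : Fin N ⊕ Fin N) : (hJ n hn i k).1.toLp ∈ hW.gaussianSpace :=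
    (hJ n hn i k).toLp_mem_gaussianSpace hW (grid_mem hM hn).2
      (memLp_indicator_scale i k (grid_mem hM hn))
  exact Submodule.sum_mem _ fun k _ => Submodule.sub_mem _ (h _ hn k)
    (h _ ((Nat.le_succ n).trans hn) k)

/-- Distinct Brownian components are uncorrelated, so only `k = l` survives; summing `volZ i k *
volZ j k` over k produces `covZ i j`. -/
lemma inner_increment (hW : IsStdBrownian A.T W P) (hM : 0 < M)
    (hJ : ∀ n ≤ M, ∀ i k, IsWienerIntegral P (fun t ω => W t ω k) 0 (A.grid M n)
      (fun s => A.scale i s * A.volZ i k) (J n i k))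
    (n m : ℕ) (hn : n + 1 ≤ M) (hm : m + 1 ≤ M) (i j : Fin N) :
    inner ℝ (increment (fun n hn i k => (hJ n hn i k).1) n hn i)
      (increment (fun n hn i k => (hJ n hn i k).1) m hm j)
      = if n = m then A.errorCov M (n + 1) i j else 0 := by
  let G : ℝ → ℝ := fun t => ∫ s in (0 : ℝ)..t, A.scale i s * A.scale j s
  have hJJ (n m : ℕ) (hn : n ≤ M) (hm : m ≤ M) (k l : Fin N ⊕ Fin N) :
      inner ℝ (hJ n hn i k).1.toLp (hJ m hm j l).1.toLp
        = if k = l then A.volZ i k * A.volZ j k * G (min (A.grid M n) (A.grid M m)) else 0 := by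
    rw [inner_toLp_eq_integral_mul, (hJ n hn i k).integral_mul hW (grid_mem hM hn) (grid_mem hM hm)
      (hJ m hm j l) (memLp_indicator_scale i k (grid_mem hM hn))
      (memLp_indicator_scale j l (grid_mem hM hm))]
    split_ifs with hkl
    · subst hkl
      rw [← intervalIntegral.integral_const_mul]
      congr 1 with u
      ring
    · rfl
  have hG := increment_cov (grid_mono (A := A) M) G n m
  have hkl (k l : Fin N ⊕ Fin N) :
      inner ℝ ((hJ (n + 1) hn i k).1.toLp - (hJ n ((Nat.le_succ n).trans hn) i k).1.toLp)
        ((hJ (m + 1) hm j l).1.toLp - (hJ m ((Nat.le_succ m).trans hm) j l).1.toLp)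
      = if k = l then A.volZ i k * A.volZ j k * (if n = m then
          G (A.grid M (n + 1 : ℕ)) - G (A.grid M n) else 0) else 0 := by
    rw [inner_sub_left, inner_sub_right, inner_sub_right, hJJ _ _ hn hm,
      hJJ _ _ hn ((Nat.le_succ m).trans hm), hJJ _ _ ((Nat.le_succ n).trans hn) hm,
      hJJ _ _ ((Nat.le_succ n).trans hn) ((Nat.le_succ m).trans hm), ← hG]
    split_ifs
    · ring
    · ring
  have hsum : inner ℝ (increment (fun n hn i k => (hJ n hn i k).1) n hn i)
      (increment (fun n hn i k => (hJ n hn i k).1) m hm j)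
      = A.covZ i j * (if n = m then G (A.grid M (n + 1 : ℕ)) - G (A.grid M n) else 0) := by
    simp_rw [increment, sum_inner, inner_sum, hkl, Finset.sum_ite_eq, Finset.mem_univ, if_true]
    rw [← Finset.sum_mul, covZ, mul_apply]
    rfl
  rw [hsum]
  split_ifs
  · have hc := (continuousOn_scale (A := A) i).mul (continuousOn_scale j)
    have h0 : (0 : ℝ) ∈ Set.Icc 0 A.T := ⟨le_rfl, A.T_pos.le⟩
    rw [errorCov, show (((n + 1 : ℕ) : ℝ) - 1) = n by push_cast; ring]
    congr 1
    exact intervalIntegral.integral_interval_sub_left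
      (intervalIntegrable_of_continuousOn hc h0 (grid_mem hM hn))
      (intervalIntegrable_of_continuousOn hc h0 (grid_mem hM ((Nat.le_succ n).trans hn)))
  · simp

end Increments

/-- The stochastic integrals in the equation of the log-basis process at the grid points. -/
lemma IsLogBasis.exists_wienerIntegral {Ω : Type*} [MeasurableSpace Ω] {P : Measure Ω}
    {W : ℝ → Ω → (Fin N ⊕ Fin N) → ℝ} {Z : ℝ → Ω → Fin N → ℝ} (hZ : A.IsLogBasis P W Z)
    {M : ℕ} (hM : 0 < M) :
    ∃ J : ℕ → Fin N → Fin N ⊕ Fin N → Ω → ℝ,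
      (∀ n ≤ M, ∀ i k, IsWienerIntegral P (fun t ω => W t ω k) 0 (A.grid M n)
        (fun s => A.scale i s * A.volZ i k) (J n i k)) ∧
      ∀ n ≤ M, ∀ᵐ ω ∂P, ∀ i, A.scale i (A.grid M n) * Z (A.grid M n) ω i
        = Z 0 ω i + (∫ s in (0 : ℝ)..A.grid M n, A.scale i s * A.m i) + ∑ k, J n i k ω := by
  -- Keeping `n ≤ M` inside the existential lets `choose` return a family indexed by all n; beyond M
  -- its values are irrelevant.
  have h (n : ℕ) : ∃ J : Fin N → Fin N ⊕ Fin N → Ω → ℝ, n ≤ M →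
      (∀ i k, IsWienerIntegral P (fun t ω => W t ω k) 0 (A.grid M n)
        (fun s => A.scale i s * A.volZ i k) (J i k)) ∧
      ∀ᵐ ω ∂P, ∀ i, A.scale i (A.grid M n) * Z (A.grid M n) ω i
        = Z 0 ω i + (∫ s in (0 : ℝ)..A.grid M n, A.scale i s * A.m i) + ∑ k, J i k ω := by
    by_cases hn : n ≤ M
    · obtain ⟨I, ⟨J, hJ, hIJ⟩, hI⟩ := hZ _ (grid_mem hM hn)
      refine ⟨J, fun _ => ⟨fun i k => ?_, ?_⟩⟩
      · simpa only [diagonal_mul] using hJ i k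
      · filter_upwards [hI, hIJ] with ω h1 h2 i
        rw [h1, h2]
    · exact ⟨0, fun h => absurd h hn⟩
  choose J hJ using h
  exact ⟨J, fun n hn => (hJ n hn).1, fun n hn => (hJ n hn).2⟩

/-- One step of the recursion satisfied by the log-basis process on the grid. -/
lemma scale_mul_step {M n : ℕ} (hM : 0 < M) (hn : n + 1 ≤ M) (i : Fin N) {z z' z₀ x x' : ℝ}
    (h : A.scale i (A.grid M n) * z
      = z₀ + (∫ s in (0 : ℝ)..A.grid M n, A.scale i s * A.m i) + x)
    (h' : A.scale i (A.grid M (n + 1 : ℕ)) * z'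
      = z₀ + (∫ s in (0 : ℝ)..A.grid M (n + 1 : ℕ), A.scale i s * A.m i) + x') :
    A.scale i (A.grid M (n + 1 : ℕ)) * z'
      = A.scale i (A.grid M n) * z + A.phi M (n + 1) i * A.m i + (x' - x) := by
  have h0 : (0 : ℝ) ∈ Set.Icc 0 A.T := ⟨le_rfl, A.T_pos.le⟩
  have ha := grid_mem (A := A) hM ((Nat.le_succ n).trans hn)
  have hb := grid_mem (A := A) hM hn
  have hc := continuousOn_scale (A := A) i
  have hadd := intervalIntegral.integral_add_adjacent_intervals
    (intervalIntegrable_of_continuousOn hc h0 ha) (intervalIntegrable_of_continuousOn hc ha hb)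
  rw [integral_scale_eq_phi hM hn] at hadd
  rw [intervalIntegral.integral_mul_const] at h h'
  rw [h, h', ← hadd]
  ring

end Market

end FuturesBasis

end

/-! ### The recursion and the joint law of the errors -/

theorem mainTheorem4 {N : ℕ} (A : FuturesBasis.Market N) {Ω : Type*} [MeasurableSpace Ω]
    (P : Measure Ω) [IsProbabilityMeasure P]
    (W : ℝ → Ω → (Fin N ⊕ Fin N) → ℝ) (hW : FuturesBasis.IsStdBrownian A.T W P)
    (Z : ℝ → Ω → Fin N → ℝ) (hZ : A.IsLogBasis P W Z) (M : ℕ) (hM : 0 < M) :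
    (∃ e : ℕ → Ω → Fin N → ℝ,
      (∀ n ∈ Finset.Icc 1 M, ∀ᵐ ω ∂P, ∀ i,
        A.scale i (A.grid M n) * Z (A.grid M n) ω i
          = A.scale i (A.grid M ((n : ℝ) - 1)) * Z (A.grid M ((n : ℝ) - 1)) ω i
            + A.phi M n i * A.m i + e n ω i) ∧
      (∀ n ∈ Finset.Icc 1 M, Measurable (e n)) ∧
      iIndepFun (fun (n : Finset.Icc 1 M) => e n) P ∧
      (∀ n ∈ Finset.Icc 1 M, HasGaussianLaw (e n) P ∧
        (∀ i, ∫ ω, e n ω i ∂P = 0) ∧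
        (∀ i j, ∫ ω, e n ω i * e n ω j ∂P = A.errorCov M n i j))) ∧
    A.covZ = A.covF + A.covS - A.covFS - A.covFSᵀ := by
  refine ⟨?_, A.covZ_eq⟩
  obtain ⟨J, hJ, hZJ⟩ := hZ.exists_wienerIntegral hM
  have hpred {n : ℕ} (hn : n ∈ Finset.Icc 1 M) : n - 1 + 1 ≤ M := by
    have := Finset.mem_Icc.1 hn
    omega
  have hsucc {n : ℕ} (hn : n ∈ Finset.Icc 1 M) : n - 1 + 1 = n :=
    Nat.sub_add_cancel (Finset.mem_Icc.1 hn).1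
  -- Error n is the increment starting at grid point n - 1. Taking L² representatives makes the
  -- errors measurable, not merely almost everywhere measurable.
  let E (p : Finset.Icc 1 M × Fin N) : Lp ℝ 2 P :=
    FuturesBasis.Market.increment (fun n hn i k => (hJ n hn i k).1) (p.1 - 1) (hpred p.1.2) p.2
  have hmem (p) : E p ∈ hW.gaussianSpace :=
    FuturesBasis.Market.increment_mem_gaussianSpace hW hM hJ _ _ _
  have hsub := hW.gaussianSpace_subset A.T_pos.le
  have hinner (p q) : ∫ ω, E p ω * E q ω ∂P
      = if (p.1 : ℕ) = q.1 then A.errorCov M p.1 p.2 q.2 else 0 := by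
    have h := FuturesBasis.Market.inner_increment hW hM hJ (p.1 - 1) (q.1 - 1)
      (hpred p.1.2) (hpred q.1.2) p.2 q.2
    rw [hsucc p.1.2] at h
    have h' : inner ℝ (E p) (E q) = ∫ ω, E p ω * E q ω ∂P := by
      have := FuturesBasis.inner_toLp_eq_integral_mul (Lp.memLp (E p)) (Lp.memLp (E q))
      rwa [Lp.toLp_coeFn, Lp.toLp_coeFn] at this
    rw [← h']
    refine h.trans (if_congr ?_ rfl rfl)
    have h1 := hsucc p.1.2
    have h2 := hsucc q.1.2
    omega
  have hzero (p) : ∫ ω, E p ω ∂P = 0 :=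
    FuturesBasis.integral_eq_zero_of_mem_centeredGaussian (hsub (hmem p))
  have hG : HasGaussianLaw (fun ω (n : Finset.Icc 1 M) (i : Fin N) => E (n, i) ω) P := by
    -- Currying is linear, so it turns the Gaussian family indexed by pairs into a Gaussian family
    -- of vectors.
    let L : (Finset.Icc 1 M × Fin N → ℝ) →L[ℝ] (Finset.Icc 1 M → Fin N → ℝ) :=
      ContinuousLinearMap.pi fun n => ContinuousLinearMap.pi fun i => ContinuousLinearMap.proj (n, i)
    exact (FuturesBasis.hasGaussianLaw_of_mem_submodule hsub hmem).map L
  let e (n : ℕ) (ω : Ω) (i : Fin N) : ℝ :=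
    if hn : n ∈ Finset.Icc 1 M then E (⟨n, hn⟩, i) ω else 0
  have he {n : ℕ} (hn : n ∈ Finset.Icc 1 M) : e n = fun ω i => E (⟨n, hn⟩, i) ω := by
    funext ω i
    simp only [e, dif_pos hn]
  refine ⟨e, fun n hn => ?_, fun n hn => ?_, ?_, fun n hn => ⟨?_, fun i => ?_, fun i j => ?_⟩⟩
  · obtain ⟨m, rfl⟩ := Nat.exists_eq_add_of_le' (Finset.mem_Icc.1 hn).1
    have hm : m + 1 ≤ M := (Finset.mem_Icc.1 hn).2
    have hE : ∀ᵐ ω ∂P, ∀ i, E (⟨m + 1, hn⟩, i) ω = ∑ k, J (m + 1) i k ω - ∑ k, J m i k ω :=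
      ae_all_iff.2 fun i => FuturesBasis.Market.increment_ae_eq (fun n hn i k => (hJ n hn i k).1) m hm i
    filter_upwards [hZJ m ((Nat.le_succ m).trans hm), hZJ (m + 1) hm, hE] with ω h1 h2 h3 i
    rw [he hn]
    beta_reduce
    rw [h3, show (((m + 1 : ℕ) : ℝ) - 1) = m by push_cast; ring]
    exact FuturesBasis.Market.scale_mul_step hM hm i (h1 i) (h2 i)
  · rw [he hn]
    exact measurable_pi_lambda _ fun i => (Lp.stronglyMeasurable _).measurable
  -- For jointly Gaussian vectors, zero cross-covariances give mutual independence; the means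
  -- vanish, so these covariances are the integrals in `hinner`.
  · have hind := hG.iIndepFun_of_covariance_eval (X := fun n i ω => E (n, i) ω) fun n m hnm i j => by
      rw [covariance_eq_sub (Lp.memLp _) (Lp.memLp _), hzero, zero_mul, sub_zero]
      refine (hinner _ _).trans (if_neg fun h => hnm (Subtype.ext h))
    convert hind using 1
    funext n
    exact he n.2
  · rw [he hn]
    exact hG.eval (X := fun n ω i => E (n, i) ω) ⟨n, hn⟩
  · simp only [he hn]
    exact hzero _
  · simp only [he hn]
    exact (hinner _ _).trans (if_pos rfl)
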